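/- Let $n>1$, $m_{\mathsf{train}}\ge 1$, $m_{\mathsf{test}}\ge 1$, $m=m_{\mathsf{train}}+m_{\mathsf{test}}$. The vocabulary $\mathcal V=\mathcal S\cup\mathcal R\cup\mathcal A\cup\{\texttt{<EOS>}\}$ consists of the subjects $\mathcal S=\{s_{i,j}: 1\le i\le n,\ 1\le j\le m\}$, the relations $\mathcal R=\{r_1,r_2\}$, the answers $\mathcal A=\mathcal A_1\cup\mathcal A_2$ with $\mathcal A_1=\{b_1,\dots,b_n\}$ (facts) and $\mathcal A_2=\{c_1,\dots,c_n\}$ (implications), and an end-of-sequence token; all these tokens are distinct. The correct answers are $a^*(s_{i,j},r_1)=b_i$ and $a^*(s_{i,j},r_2)=c_i$. The subject $s_{i,j}$ is a training subject if $j\le m_{\mathsf{train}}$ and a test subject otherwise. The training pairs $\mathcal D_{\mathsf{train}}$ are the pairs $(s,r_1)$ and $(s,r_2)$ with $s$ a training subject, together with the pairs $(s,r_1)$ with $s$ a test subject; the test pairs $\mathcal D_{\mathsf{test}}$ are the pairs $(s,r_2)$ with $s$ a test subject. For a matrix $W\in\mathbb R^{\mathcal V\times\mathcal V}$, $(s,r)\in\mathcal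 S\times\mathcal R$ and $a'\in\mathcal A$, define the margin $$h_{(s,r),a'}(W)=\bigl(W_{a^*(s,r),s}+W_{a^*(s,r),r}\bigr)-\bigl(W_{a',s}+W_{a',r}\bigr).$$ Call $W$ feasible if $h_{(s,r),a'}(W)\ge 1$ for all $(s,r)\in\mathcal D_{\mathsf{train}}$ and all $a'\in\mathcal A\setminus\{a^*(s,r)\}$. Let $\|\cdot\|_\star$ be the nuclear norm (sum of singular values) and $\|\cdot\|_F$ the Frobenius norm. 1. (Factorized model.) Let $W$ be a minimizer of $\tfrac12\|W\|_\star^2$ over the feasible matrices, and let $\overline W\in\mathbb R^{2n\times(nm+2)}$ be its block with rows indexed by $\mathcal A$ and columns indexed by $\mathcal S\cup\mathcal R$. Assume the following regularity condition: either $\mathbf 1_{2n}^\top\overline W\neq \mathbf 0^\top$, or there are real numbers $p_1,p_2,q_1,q_2,f_1,f_2,g_1,g_2,\beta_1,\beta_2,\gamma_1,\gamma_2$ such that, for all $i,k\in\{1,\dots,n\}$, - $\overline W_{b_i,s_{k,j}}=p_1\delta_{ik}+p_2$ and $\overline W_{c_i,s_{k,j}}=q_1\delta_{ik}+q_2$ for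 $j\le m_{\mathsf{train}}$, - $\overline W_{b_i,s_{k,j}}=f_1\delta_{ik}+f_2$ and $\overline W_{c_i,s_{k,j}}=g_1\delta_{ik}+g_2$ for $j>m_{\mathsf{train}}$, - $\overline W_{b_i,r_1}=\beta_1$, $\overline W_{b_i,r_2}=\beta_2$, $\overline W_{c_i,r_1}=\gamma_1$, $\overline W_{c_i,r_2}=\gamma_2$. Then for every $(s,r)\in\mathcal D_{\mathsf{test}}$ and every $a'\in\mathcal A\setminus\{a^*(s,r)\}$, $$h_{(s,r),a'}(W)\ \ge\ \min\Bigl\{\sqrt{m_{\mathsf{train}}/m_{\mathsf{test}}},\,1\Bigr\}.$$ 2. (Non-factorized model.) Let $W$ be a minimizer of $\tfrac12\|W\|_F^2$ over the feasible matrices. Then for every $(s,r)\in\mathcal D_{\mathsf{test}}$ and every $a'\in\mathcal A_2\setminus\{a^*(s,r)\}$, $$h_{(s,r),a'}(W)=0.$$ -/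

import Mathlib

open scoped Matrix

namespace OCR

/-- The two relation tokens: the fact relation `r₁` and the implication relation `r₂`. -/
inductive Relation : Type
  | r₁
  | r₂
  deriving DecidableEq

instance : Fintype Relation := ⟨{.r₁, .r₂}, fun r => by cases r <;> simp⟩

/-- The answer tokens: the fact answers `b i` (the set `A₁`) and the implication answers `c i`
(the set `A₂`), for `i` in an `n`-element set. -/
inductive Answer (n : ℕ) : Type
  | b (i : Fin n)
  | c (i : Fin n)
  deriving DecidableEq, Fintype

/-- The subject tokens: in each of the `n` classes there are `mtrain` training subjects
(`Sum.inl j`) and `mtest` test subjects (`Sum.inr j`). -/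
abbrev Subject (n mtrain mtest : ℕ) : Type := Fin n × (Fin mtrain ⊕ Fin mtest)

/-- The vocabulary: subjects, relations, answers and the end-of-sequence token. -/
inductive Token (n mtrain mtest : ℕ) : Type
  | subj (s : Subject n mtrain mtest)
  | rel (r : Relation)
  | ans (a : Answer n)
  | eos
  deriving DecidableEq, Fintype

/-- The set `A₂` of implication answers. -/
def implicationAnswers (n : ℕ) : Set (Answer n) := Set.range Answer.c

/-- The correct answer: a subject of class `i` has fact `b i` and implication `c i`. -/
def correctAnswer {n mtrain mtest : ℕ} (s : Subject n mtrain mtest) : Relation → Answer n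
  | .r₁ => .b s.1
  | .r₂ => .c s.1

/-- The training subjects. -/
def trainSubjects (n mtrain mtest : ℕ) : Set (Subject n mtrain mtest) := {s | s.2.isLeft}

/-- The test subjects. -/
def testSubjects (n mtrain mtest : ℕ) : Set (Subject n mtrain mtest) := {s | s.2.isRight}

/-- The (subject, relation) pairs of the training data: facts and implications of the training
subjects, and facts of the test subjects. -/
def trainPairs (n mtrain mtest : ℕ) : Set (Subject n mtrain mtest × Relation) :=
  trainSubjects n mtrain mtest ×ˢ {.r₁} ∪ trainSubjects n mtrain mtest ×ˢ {.r₂} ∪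
    testSubjects n mtrain mtest ×ˢ {.r₁}

/-- The (subject, relation) pairs of the test data: implications of the test subjects. -/
def testPairs (n mtrain mtest : ℕ) : Set (Subject n mtrain mtest × Relation) :=
  testSubjects n mtrain mtest ×ˢ {.r₂}

/-- Output-value matrices: real square matrices indexed by the vocabulary. -/
abbrev OVMatrix (n mtrain mtest : ℕ) : Type :=
  Matrix (Token n mtrain mtest) (Token n mtrain mtest) ℝ

section

variable {n mtrain mtest : ℕ}

/-- The logit of the answer `a` on the input `(s, r)`, with equal attention to `s` and `r`. -/
def logit (W : OVMatrix n mtrain mtest) (s : Subject n mtrain mtest) (r : Relation)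
    (a : Answer n) : ℝ :=
  W (.ans a) (.subj s) + W (.ans a) (.rel r)

/-- The margin between the correct answer to `(s, r)` and the answer `a'`. -/
def margin (W : OVMatrix n mtrain mtest) (s : Subject n mtrain mtest) (r : Relation)
    (a' : Answer n) : ℝ :=
  logit W s r (correctAnswer s r) - logit W s r a'

/-- The feasible set of both SVM problems: margin at least `1` against every wrong answer on every
training pair. -/
def feasibleSet (n mtrain mtest : ℕ) : Set (OVMatrix n mtrain mtest) :=
  {W | ∀ s r, (s, r) ∈ trainPairs n mtrain mtest → ∀ a', a' ≠ correctAnswer s r →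
    1 ≤ margin W s r a'}

/-- The nuclear norm of a real matrix: the sum of its singular values. -/
noncomputable def nuclearNorm {ρ κ : Type*} [Fintype ρ] [Fintype κ] [DecidableEq κ]
    (M : Matrix ρ κ ℝ) : ℝ :=
  ∑ i ∈ Finset.range (Fintype.card κ), (Matrix.toEuclideanLin M).singularValues i

/-- The Frobenius norm of a real matrix. -/
noncomputable def frobeniusNorm {ρ κ : Type*} [Fintype ρ] [Fintype κ] (M : Matrix ρ κ ℝ) : ℝ :=
  Matrix.frobeniusNormedAddCommGroup.toNorm.norm M

/-- `W` is a global minimizer of the nuclear-norm SVM (factorized model). -/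
def IsNuclearSVMSolution (W : OVMatrix n mtrain mtest) : Prop :=
  W ∈ feasibleSet n mtrain mtest ∧
    IsMinOn (fun W' => 1 / 2 * nuclearNorm W' ^ 2) (feasibleSet n mtrain mtest) W

/-- `W` is a global minimizer of the Frobenius-norm SVM (non-factorized model). -/
def IsFrobeniusSVMSolution (W : OVMatrix n mtrain mtest) : Prop :=
  W ∈ feasibleSet n mtrain mtest ∧
    IsMinOn (fun W' => 1 / 2 * frobeniusNorm W' ^ 2) (feasibleSet n mtrain mtest) W

/-- The `2n × (n (mtrain + mtest) + 2)` block of `W` with rows indexed by the answers and columns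
indexed by the subjects and the relations. -/
def reducedBlock (W : OVMatrix n mtrain mtest) :
    Matrix (Answer n) (Subject n mtrain mtest ⊕ Relation) ℝ :=
  W.submatrix .ans (Sum.elim .subj .rel)

/-- The symmetric block form: the four subject blocks are of the form `x • I + y • E`, with `E` the
all-ones matrix, with the same coefficients for all training and for all test subjects, and the
relation columns are constant on the fact rows and on the implication rows. -/
def IsSymmetricForm (M : Matrix (Answer n) (Subject n mtrain mtest ⊕ Relation) ℝ) : Prop :=
  ∃ p₁ p₂ q₁ q₂ f₁ f₂ g₁ g₂ β₁ β₂ γ₁ γ₂ : ℝ,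
    (∀ i k j, M (.b i) (.inl (k, .inl j)) = p₁ * (1 : Matrix (Fin n) (Fin n) ℝ) i k + p₂) ∧
    (∀ i k j, M (.c i) (.inl (k, .inl j)) = q₁ * (1 : Matrix (Fin n) (Fin n) ℝ) i k + q₂) ∧
    (∀ i k j, M (.b i) (.inl (k, .inr j)) = f₁ * (1 : Matrix (Fin n) (Fin n) ℝ) i k + f₂) ∧
    (∀ i k j, M (.c i) (.inl (k, .inr j)) = g₁ * (1 : Matrix (Fin n) (Fin n) ℝ) i k + g₂) ∧
    (∀ i, M (.b i) (.inr .r₁) = β₁) ∧ (∀ i, M (.b i) (.inr .r₂) = β₂) ∧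
    (∀ i, M (.c i) (.inr .r₁) = γ₁) ∧ (∀ i, M (.c i) (.inr .r₂) = γ₂)

/-- The regularity condition: the reduced block is of the symmetric form, or it is nondegenerate in
the sense that its vector of column sums is nonzero. -/
def RegularityCondition (W : OVMatrix n mtrain mtest) : Prop :=
  IsSymmetricForm (reducedBlock W) ∨ (1 : Answer n → ℝ) ᵥ* reducedBlock W ≠ 0

end

end OCR

/-! Factorized model: convex duality with matching bounds. The nuclear norm is the maximum of the
trace pairing over contractions (`pairing_le_nuclearNorm`, `exists_pairing_eq_nuclearNorm`). Margins
only compare answer rows, so projecting out the all-ones answer direction keeps feasibility, and by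
`nuclearNorm_deflate_lt` it strictly lowers the norm unless that component is already zero. A
minimizer thus has vanishing column sums, so the regularity condition leaves only the symmetric
form.

Put a = √mtrain and b = √mtest. A symmetric block splits into `!![a * p₁, b * f₁; a * q₁, b * g₁]`,
acting on mean-zero class vectors (dimension n - 1), and a part carried by class means. The
contractions `certificate` bound the norm below by n - 1 times the nuclear norm of the 2×2 matrix
plus a term measuring the fact-minus-implication means. Feasibility makes these at least `(n - 1) *
blockOptimum a b` and √n, and `exists_feasible_nuclearNorm_le` shows that the optimum is no larger
than their sum. Hence both bounds are tight, and `block_minimizer` and `separation_tight` pin down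
f₁, a lower bound on g₁, and the relation bias, which give the test margin. The unconstrained g₁ is
forced up because coupling the two answer blocks lowers the nuclear norm.

Non-factorized model: strict convexity makes the minimizer unique, so it is fixed by every
norm-preserving change that keeps it feasible. Class permutations make the relation columns constant
on implications; then any two implication entries of a test-subject column may be exchanged, as no
training constraint distinguishes them. -/

namespace OCR

open scoped RealInnerProductSpace

/-! ### Duality between the nuclear norm and contractions. -/

section Nuclear

variable {ρ κ : Type*} [Fintype ρ] [Fintype κ]

/-- A real matrix that does not increase the Euclidean norm. -/
def IsContraction (Y : Matrix ρ κ ℝ) : Prop :=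
  ∀ v : κ → ℝ, (Y *ᵥ v) ⬝ᵥ (Y *ᵥ v) ≤ v ⬝ᵥ v

/-- The trace inner product of two real matrices. -/
def pairing (Y M : Matrix ρ κ ℝ) : ℝ := ∑ i, ∑ j, Y i j * M i j

lemma norm_sq_eq_dotProduct (v : EuclideanSpace ℝ κ) : ‖v‖ ^ 2 = v.ofLp ⬝ᵥ v.ofLp := by
  rw [EuclideanSpace.real_norm_sq_eq]
  simp [dotProduct, sq]

variable [DecidableEq κ]

lemma IsContraction.norm_le {Y : Matrix ρ κ ℝ} (hY : IsContraction Y) (v : EuclideanSpace ℝ κ) :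
    ‖Y.toEuclideanLin v‖ ≤ ‖v‖ := by
  refine le_of_sq_le_sq ?_ (norm_nonneg _)
  rw [norm_sq_eq_dotProduct, norm_sq_eq_dotProduct]
  exact hY v.ofLp

lemma isContraction_of_norm_le {Y : Matrix ρ κ ℝ}
    (hY : ∀ v : EuclideanSpace ℝ κ, ‖Y.toEuclideanLin v‖ ≤ ‖v‖) : IsContraction Y := by
  intro v
  have h := pow_le_pow_left₀ (norm_nonneg _) (hY (WithLp.toLp 2 v)) 2
  rwa [norm_sq_eq_dotProduct, norm_sq_eq_dotProduct] at h

lemma pairing_eq_sum_inner {ι : Type*} [Fintype ι] (e : OrthonormalBasis ι ℝ (EuclideanSpace ℝ κ))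
    (Y M : Matrix ρ κ ℝ) :
    pairing Y M = ∑ l, ⟪Y.toEuclideanLin (e l), M.toEuclideanLin (e l)⟫ := by
  have h1 := LinearMap.trace_eq_sum_inner (LinearMap.adjoint Y.toEuclideanLin ∘ₗ M.toEuclideanLin) e
  have h2 := LinearMap.trace_eq_sum_inner (LinearMap.adjoint Y.toEuclideanLin ∘ₗ M.toEuclideanLin)
    (EuclideanSpace.basisFun κ ℝ)
  simp only [LinearMap.comp_apply, LinearMap.adjoint_inner_right] at h1 h2
  rw [← h1, h2, pairing, Finset.sum_comm]
  refine Finset.sum_congr rfl fun j _ => ?_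
  simp [PiLp.inner_apply, mul_comm]

/-- An eigenbasis of the Gram operator `T* T` consists of right singular vectors; their images are
orthogonal, with the singular values as lengths. -/
lemma exists_singular_basis (M : Matrix ρ κ ℝ) :
    ∃ e : OrthonormalBasis (Fin (Fintype.card κ)) ℝ (EuclideanSpace ℝ κ),
      (∀ i j, i ≠ j → ⟪M.toEuclideanLin (e i), M.toEuclideanLin (e j)⟫ = 0) ∧
      nuclearNorm M = ∑ i, ‖M.toEuclideanLin (e i)‖ := by
  set T := M.toEuclideanLin
  have hfr : Module.finrank ℝ (EuclideanSpace ℝ κ) = Fintype.card κ := finrank_euclideanSpace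
  have hS := T.isSymmetric_adjoint_comp_self
  have key : ∀ i j, ⟪T (hS.eigenvectorBasis hfr i), T (hS.eigenvectorBasis hfr j)⟫
      = hS.eigenvalues hfr j * ⟪hS.eigenvectorBasis hfr i, hS.eigenvectorBasis hfr j⟫ := by
    intro i j
    rw [← LinearMap.adjoint_inner_right]
    have := hS.apply_eigenvectorBasis hfr j
    rw [LinearMap.comp_apply] at this
    rw [this, inner_smul_right]
    rfl
  refine ⟨hS.eigenvectorBasis hfr, fun i j hij => ?_, ?_⟩
  · rw [key, (hS.eigenvectorBasis hfr).orthonormal.inner_eq_zero hij, mul_zero]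
  · rw [nuclearNorm, Finset.sum_range]
    refine Finset.sum_congr rfl fun i _ => ?_
    rw [LinearMap.singularValues_fin _ hfr, ← Real.sqrt_sq (norm_nonneg _),
      ← real_inner_self_eq_norm_sq, key, real_inner_self_eq_norm_sq,
      (hS.eigenvectorBasis hfr).norm_eq_one, one_pow, mul_one]

lemma pairing_le_nuclearNorm {Y : Matrix ρ κ ℝ} (hY : IsContraction Y) (M : Matrix ρ κ ℝ) :
    pairing Y M ≤ nuclearNorm M := by
  obtain ⟨e, -, he⟩ := exists_singular_basis M
  rw [he, pairing_eq_sum_inner e]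
  refine Finset.sum_le_sum fun i _ => (real_inner_le_norm _ _).trans ?_
  have := hY.norm_le (e i)
  rw [e.norm_eq_one] at this
  exact mul_le_of_le_one_left (norm_nonneg _) this

lemma exists_pairing_eq_nuclearNorm (M : Matrix ρ κ ℝ) :
    ∃ Y : Matrix ρ κ ℝ, IsContraction Y ∧ pairing Y M = nuclearNorm M := by
  obtain ⟨e, horth, he⟩ := exists_singular_basis M
  set T := M.toEuclideanLin
  -- As `0⁻¹ = 0`, a zero singular value gives `u i = 0`; the map `e i ↦ u i` is a partial isometry,
  -- the polar factor of `M`.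
  let u := fun i => ‖T (e i)‖⁻¹ • T (e i)
  have hu : ∀ i j, i ≠ j → ⟪u i, u j⟫ = 0 := fun i j hij => by
    simp [u, inner_smul_left, inner_smul_right, horth i j hij]
  have hu1 : ∀ i, ‖u i‖ ≤ 1 := fun i => by
    simp only [u, norm_smul, norm_inv, norm_norm]
    exact inv_mul_le_one
  let L := e.toBasis.constr ℝ u
  have hL : ∀ i, L (e i) = u i := fun i => by
    have := e.toBasis.constr_basis ℝ u i
    rwa [e.coe_toBasis] at this
  refine ⟨Matrix.toEuclideanLin.symm L, isContraction_of_norm_le fun v => ?_, ?_⟩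
  · rw [LinearEquiv.apply_symm_apply]
    refine le_of_sq_le_sq ?_ (norm_nonneg _)
    have hv : L v = ∑ i, ⟪e i, v⟫ • u i := by
      conv_lhs => rw [← e.sum_repr' v]
      simp [hL]
    rw [← e.sum_sq_inner_right v, ← real_inner_self_eq_norm_sq, hv, sum_inner]
    refine Finset.sum_le_sum fun i _ => ?_
    rw [inner_sum, Finset.sum_eq_single i]
    · rw [inner_smul_left, inner_smul_right, real_inner_self_eq_norm_sq]
      have : ‖u i‖ ^ 2 ≤ 1 := pow_le_one₀ (norm_nonneg _) (hu1 i)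
      simp only [conj_trivial]
      nlinarith [mul_nonneg (sq_nonneg (⟪e i, v⟫)) (sub_nonneg.2 this)]
    · intro j _ hj
      simp [inner_smul_left, inner_smul_right, hu i j hj.symm]
    · simp
  · rw [he, pairing_eq_sum_inner e]
    refine Finset.sum_congr rfl fun i _ => ?_
    rw [LinearEquiv.apply_symm_apply, hL, inner_smul_left, real_inner_self_eq_norm_sq]
    simp only [conj_trivial]
    rcases eq_or_ne ‖T (e i)‖ 0 with h | h
    · simp [T] at h ⊢; simp [h]
    · field_simp

lemma nuclearNorm_nonneg (M : Matrix ρ κ ℝ) : 0 ≤ nuclearNorm M :=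
  Finset.sum_nonneg fun i _ => LinearMap.singularValues_nonneg _ i

lemma dotProduct_le_half (x y : ρ → ℝ) : x ⬝ᵥ y ≤ (x ⬝ᵥ x + y ⬝ᵥ y) / 2 := by
  simp only [dotProduct, ← Finset.sum_add_distrib, Finset.sum_div]
  exact Finset.sum_le_sum fun i _ => by nlinarith [sq_nonneg (x i - y i)]

/-- Pair with an optimal contraction and apply `x * y ≤ (x² + y²) / 2` column by column. Upper
bounds on the nuclear norm then come from explicit factorizations. -/
lemma nuclearNorm_mul_transpose_le {ι : Type*} [Fintype ι] (A : Matrix ρ ι ℝ) (B : Matrix κ ι ℝ) :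
    nuclearNorm (A * Bᵀ) ≤ ((∑ i, ∑ l, A i l ^ 2) + ∑ j, ∑ l, B j l ^ 2) / 2 := by
  obtain ⟨Y, hY, h⟩ := exists_pairing_eq_nuclearNorm (A * Bᵀ)
  rw [← h, Finset.sum_comm, Finset.sum_comm (s := (Finset.univ : Finset κ)),
    ← Finset.sum_add_distrib, Finset.sum_div]
  have : pairing Y (A * Bᵀ) = ∑ l, (Y *ᵥ fun j => B j l) ⬝ᵥ fun i => A i l := by
    simp only [pairing, Matrix.mul_apply, Matrix.transpose_apply, dotProduct, Matrix.mulVec,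
      Finset.mul_sum, Finset.sum_mul]
    rw [Finset.sum_comm (s := (Finset.univ : Finset ι))]
    refine Finset.sum_congr rfl fun i _ => ?_
    rw [Finset.sum_comm (s := (Finset.univ : Finset ι))]
    exact Finset.sum_congr rfl fun j _ => Finset.sum_congr rfl fun l _ => by ring
  rw [this]
  refine Finset.sum_le_sum fun l _ => (dotProduct_le_half _ _).trans ?_
  have h1 := hY fun j => B j l
  have h2 : ((fun j => B j l) ⬝ᵥ fun j => B j l) = ∑ j, B j l ^ 2 := by simp [dotProduct, sq]
  have h3 : ((fun j => A j l) ⬝ᵥ fun j => A j l) = ∑ j, A j l ^ 2 := by simp [dotProduct, sq]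
  rw [h3]
  rw [h2] at h1
  linarith

end Nuclear

/-! ### Projecting out a row direction strictly lowers the nuclear norm. -/

section Deflation

variable {ρ κ : Type*} [Fintype ρ] [Fintype κ]

/-- Removal of the component along `u` from every column of `M`. -/
def deflate (u : ρ → ℝ) (M : Matrix ρ κ ℝ) : Matrix ρ κ ℝ := M - Matrix.vecMulVec u (u ᵥ* M)

lemma pairing_deflate_comm (u : ρ → ℝ) (Y M : Matrix ρ κ ℝ) :
    pairing (deflate u Y) M = pairing Y (deflate u M) := by
  have h : ∀ A B : Matrix ρ κ ℝ, pairing (deflate u A) B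
      = pairing A B - (u ᵥ* A) ⬝ᵥ (u ᵥ* B) := by
    intro A B
    have : (u ᵥ* A) ⬝ᵥ (u ᵥ* B) = ∑ i, ∑ j, u i * (u ᵥ* A) j * B i j := by
      rw [Finset.sum_comm]
      refine Finset.sum_congr rfl fun j _ => ?_
      rw [show (u ᵥ* B) j = ∑ i, u i * B i j from rfl, Finset.mul_sum]
      exact Finset.sum_congr rfl fun i _ => by ring
    rw [this, pairing, pairing, ← Finset.sum_sub_distrib]
    refine Finset.sum_congr rfl fun i _ => ?_
    rw [← Finset.sum_sub_distrib]
    exact Finset.sum_congr rfl fun j _ => by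
      simp only [deflate, Matrix.sub_apply, Matrix.vecMulVec_apply]; ring
  have hc : ∀ A B : Matrix ρ κ ℝ, pairing A B = pairing B A := fun A B => by
    simp only [pairing, mul_comm]
  rw [hc Y (deflate u M), h, h, hc M, dotProduct_comm]

lemma deflate_mulVec (u : ρ → ℝ) (M : Matrix ρ κ ℝ) (v : κ → ℝ) :
    deflate u M *ᵥ v = M *ᵥ v - (u ⬝ᵥ (M *ᵥ v)) • u := by
  rw [deflate, Matrix.sub_mulVec, Matrix.vecMulVec_mulVec, Matrix.dotProduct_mulVec]
  simp

lemma dotProduct_deflate_mulVec {u : ρ → ℝ} (hu : u ⬝ᵥ u = 1) (M : Matrix ρ κ ℝ) (v : κ → ℝ) :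
    u ⬝ᵥ (deflate u M *ᵥ v) = 0 := by
  rw [deflate_mulVec, dotProduct_sub, dotProduct_smul, hu]
  simp

lemma IsContraction.deflate {u : ρ → ℝ} (hu : u ⬝ᵥ u = 1) {Y : Matrix ρ κ ℝ}
    (hY : IsContraction Y) : IsContraction (deflate u Y) := by
  intro v
  have h := hY v
  rw [deflate_mulVec]
  simp only [sub_dotProduct, dotProduct_sub, smul_dotProduct, dotProduct_smul, hu, smul_eq_mul,
    dotProduct_comm (Y *ᵥ v) u]
  nlinarith [sq_nonneg (u ⬝ᵥ (Y *ᵥ v))]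

lemma pairing_add_left (Y Z M : Matrix ρ κ ℝ) :
    pairing (Y + Z) M = pairing Y M + pairing Z M := by
  simp [pairing, add_mul, Finset.sum_add_distrib]

lemma pairing_smul_left (c : ℝ) (Y M : Matrix ρ κ ℝ) :
    pairing (c • Y) M = c * pairing Y M := by
  simp [pairing, mul_assoc, Finset.mul_sum]

lemma pairing_vecMulVec (u : ρ → ℝ) (w : κ → ℝ) (M : Matrix ρ κ ℝ) :
    pairing (Matrix.vecMulVec u w) M = (u ᵥ* M) ⬝ᵥ w := by
  rw [pairing, Finset.sum_comm]
  simp only [dotProduct, Matrix.vecMul, Finset.sum_mul, Matrix.vecMulVec_apply]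
  exact Finset.sum_congr rfl fun j _ => Finset.sum_congr rfl fun i _ => by ring

lemma dotProduct_sq_le (x y : ρ → ℝ) : (x ⬝ᵥ y) ^ 2 ≤ (x ⬝ᵥ x) * (y ⬝ᵥ y) := by
  simpa [dotProduct, sq] using Finset.sum_mul_sq_le_sq_mul_sq Finset.univ x y

variable [DecidableEq κ]

/-- An optimal contraction for the deflated matrix, itself deflated, has range orthogonal to `u`.
Mixing it with the rank-one matrix `u wᵀ` in proportion `N : 1` and normalizing by `S = √(N² + w ⬝ᵥ
w)` keeps it a contraction; its pairing with `M` is `S > N`. -/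
lemma nuclearNorm_deflate_lt {u : ρ → ℝ} (hu : u ⬝ᵥ u = 1) {M : Matrix ρ κ ℝ}
    (hM : u ᵥ* M ≠ 0) : nuclearNorm (deflate u M) < nuclearNorm M := by
  obtain ⟨Y, hY, hYM⟩ := exists_pairing_eq_nuclearNorm (deflate u M)
  set w := u ᵥ* M with hw
  set N := nuclearNorm (deflate u M) with hN
  have hN0 : 0 ≤ N := nuclearNorm_nonneg _
  have hd : 0 < w ⬝ᵥ w := by
    have h0 : 0 ≤ w ⬝ᵥ w := Finset.sum_nonneg fun i _ => mul_self_nonneg _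
    exact lt_of_le_of_ne h0 fun h => hM (dotProduct_self_eq_zero.1 h.symm)
  set S := Real.sqrt (N ^ 2 + w ⬝ᵥ w) with hS
  have hSpos : 0 < S := Real.sqrt_pos.2 (by positivity)
  have hSsq : S ^ 2 = N ^ 2 + w ⬝ᵥ w := Real.sq_sqrt (by positivity)
  have hNS : N < S := lt_of_pow_lt_pow_left₀ 2 hSpos.le (by linarith)
  have hcon : IsContraction ((N / S) • deflate u Y + (1 / S) • Matrix.vecMulVec u w) := by
    intro v
    have h1 := hY.deflate hu v
    have h2 := dotProduct_sq_le w v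
    have h3 := dotProduct_deflate_mulVec hu Y v
    have h4 : 0 ≤ v ⬝ᵥ v := Finset.sum_nonneg fun i _ => mul_self_nonneg _
    rw [Matrix.add_mulVec, Matrix.smul_mulVec, Matrix.smul_mulVec, Matrix.vecMulVec_mulVec]
    simp only [add_dotProduct, dotProduct_add, smul_dotProduct, dotProduct_smul, hu, smul_eq_mul,
      op_smul_eq_smul,
      dotProduct_comm (deflate u Y *ᵥ v) u, h3]
    have h5 : (N / S) ^ 2 + (1 / S) ^ 2 * (w ⬝ᵥ w) = 1 := by
      field_simp; linarith
    calc _ = (N / S) ^ 2 * ((deflate u Y *ᵥ v) ⬝ᵥ (deflate u Y *ᵥ v))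
          + (1 / S) ^ 2 * (w ⬝ᵥ v) ^ 2 := by ring
      _ ≤ (N / S) ^ 2 * (v ⬝ᵥ v) + (1 / S) ^ 2 * ((w ⬝ᵥ w) * (v ⬝ᵥ v)) := by gcongr
      _ = ((N / S) ^ 2 + (1 / S) ^ 2 * (w ⬝ᵥ w)) * (v ⬝ᵥ v) := by ring
      _ = _ := by rw [h5, one_mul]
  have h := pairing_le_nuclearNorm hcon M
  rw [pairing_add_left, pairing_smul_left, pairing_smul_left, pairing_vecMulVec,
    pairing_deflate_comm, hYM, ← hw] at h
  have : N / S * N + 1 / S * (w ⬝ᵥ w) = S := by field_simp; linarith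
  linarith

end Deflation

/-! ### Sums over tokens, and vanishing column sums at a nuclear-norm minimizer. -/

section Tokens

variable {n mtrain mtest : ℕ}

lemma sum_answer {α : Type*} [AddCommMonoid α] (f : Answer n → α) :
    ∑ a, f a = ∑ i, f (.b i) + ∑ i, f (.c i) := by
  let e : Fin n ⊕ Fin n ≃ Answer n :=
    { toFun := Sum.elim .b .c
      invFun := fun a => match a with
        | .b i => .inl i
        | .c i => .inr i
      left_inv := by rintro (i | i) <;> rfl
      right_inv := by rintro (i | i) <;> rfl }
  rw [← e.sum_comp, Fintype.sum_sum_type]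
  rfl

lemma card_answer (n : ℕ) : (Fintype.card (Answer n) : ℝ) = 2 * n := by
  have h := sum_answer fun _ : Answer n => (1 : ℝ)
  simp only [Finset.sum_const, Finset.card_univ, Fintype.card_fin, nsmul_eq_mul, mul_one] at h
  rw [h]
  ring

lemma sum_relation {α : Type*} [AddCommMonoid α] (f : Relation → α) :
    ∑ r, f r = f .r₁ + f .r₂ := by
  have : (Finset.univ : Finset Relation) = {.r₁, .r₂} := rfl
  rw [this, Finset.sum_pair (by simp)]

lemma sum_token {α : Type*} [AddCommMonoid α] (f : Token n mtrain mtest → α) :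
    ∑ x, f x = (∑ s, f (.subj s) + ∑ r, f (.rel r)) + (∑ a, f (.ans a) + f .eos) := by
  let e : (Subject n mtrain mtest ⊕ Relation) ⊕ (Answer n ⊕ Unit) ≃ Token n mtrain mtest :=
    { toFun := Sum.elim (Sum.elim .subj .rel) (Sum.elim .ans fun _ => .eos)
      invFun := fun a => match a with
        | .subj i => .inl (.inl i)
        | .rel i => .inl (.inr i)
        | .ans i => .inr (.inl i)
        | .eos => .inr (.inr ())
      left_inv := by rintro ((i | i) | (i | i)) <;> rfl
      right_inv := by rintro (i | i | i | i) <;> rfl }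
  rw [← e.sum_comp, Fintype.sum_sum_type, Fintype.sum_sum_type, Fintype.sum_sum_type]
  simp [e]

lemma sum_subject {α : Type*} [AddCommMonoid α] (f : Subject n mtrain mtest → α) :
    ∑ s, f s = ∑ i, (∑ j, f (i, .inl j) + ∑ j, f (i, .inr j)) := by
  rw [Fintype.sum_prod_type]
  exact Finset.sum_congr rfl fun i _ => Fintype.sum_sum_type _

/-- The normalized indicator vector of the answer tokens. -/
noncomputable def answerVector (n mtrain mtest : ℕ) : Token n mtrain mtest → ℝ
  | .ans _ => (Real.sqrt (2 * n))⁻¹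
  | _ => 0

lemma answerVector_dotProduct_self (hn : 1 < n) :
    answerVector n mtrain mtest ⬝ᵥ answerVector n mtrain mtest = 1 := by
  have hn0 : (0 : ℝ) < n := by exact_mod_cast (by omega : 0 < n)
  have h : Real.sqrt (2 * n) * Real.sqrt (2 * n) = 2 * n := Real.mul_self_sqrt (by positivity)
  rw [dotProduct, sum_token]
  simp only [answerVector, mul_zero, Finset.sum_const_zero, zero_add, add_zero,
    Finset.sum_const, Finset.card_univ, card_answer, nsmul_eq_mul, ← mul_inv, h]
  field_simp

lemma margin_deflate_answerVector (W : OVMatrix n mtrain mtest) (s : Subject n mtrain mtest)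
    (r : Relation) (a' : Answer n) :
    margin (deflate (answerVector n mtrain mtest) W) s r a' = margin W s r a' := by
  simp only [margin, logit, deflate, Matrix.sub_apply, Matrix.vecMulVec_apply, answerVector]
  ring

/-- The column sums of the reduced block of a nuclear-norm SVM solution vanish. -/
lemma IsNuclearSVMSolution.vecMul_reducedBlock (hn : 1 < n) {W : OVMatrix n mtrain mtest}
    (hW : IsNuclearSVMSolution W) : (1 : Answer n → ℝ) ᵥ* reducedBlock W = 0 := by
  have hn0 : (0 : ℝ) < n := by exact_mod_cast (by omega : 0 < n)
  set u := answerVector n mtrain mtest with hu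
  have hzero : u ᵥ* W = 0 := by
    by_contra h
    have hlt := nuclearNorm_deflate_lt (answerVector_dotProduct_self hn) h
    have hmem : deflate u W ∈ feasibleSet n mtrain mtest := fun s r hsr a' ha' => by
      rw [margin_deflate_answerVector]
      exact hW.1 s r hsr a' ha'
    have hle := hW.2 hmem
    have h0 := nuclearNorm_nonneg (deflate u W)
    simp only [Set.mem_ofPred_eq] at hle
    nlinarith
  have hcol : ∀ y, ∑ a, W (.ans a) y = 0 := fun y => by
    have h := congrFun hzero y
    rw [Matrix.vecMul, dotProduct, sum_token] at h
    simp only [hu, answerVector, zero_mul, Finset.sum_const_zero, zero_add, add_zero,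
      ← Finset.mul_sum, Pi.zero_apply, mul_eq_zero, inv_eq_zero] at h
    exact h.resolve_left (Real.sqrt_pos.2 (by positivity)).ne'
  ext y
  simp [Matrix.vecMul, dotProduct, reducedBlock, hcol]

end Tokens

/-! ### Dual certificates adapted to the symmetric form. -/

section Certificate

variable {n mtrain mtest : ℕ}

/-- The centering matrix `I - E / n`. -/
noncomputable def centering (n : ℕ) : Matrix (Fin n) (Fin n) ℝ := 1 - Matrix.of fun _ _ => (n : ℝ)⁻¹

lemma centering_apply (i k : Fin n) :
    centering n i k = (1 : Matrix (Fin n) (Fin n) ℝ) i k - (n : ℝ)⁻¹ := rfl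

lemma sum_centering_mul (i : Fin n) (z : Fin n → ℝ) :
    ∑ k, centering n i k * z k = z i - (∑ k, z k) / n := by
  simp only [centering_apply, sub_mul, Finset.sum_sub_distrib, Matrix.one_apply, ite_mul, one_mul,
    zero_mul, Finset.sum_ite_eq, Finset.mem_univ, if_true, ← Finset.mul_sum]
  ring

lemma weighted_cauchy {N : ℝ} (hN : 0 ≤ N) (a b c d x y z w : ℝ) :
    (N * a * x + N * b * y + c * z + d * w) ^ 2
      ≤ (N * (a ^ 2 + b ^ 2) + (c ^ 2 + d ^ 2)) * (N * (x ^ 2 + y ^ 2) + (z ^ 2 + w ^ 2)) := by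
  have h : (N * (a ^ 2 + b ^ 2) + (c ^ 2 + d ^ 2)) * (N * (x ^ 2 + y ^ 2) + (z ^ 2 + w ^ 2))
      - (N * a * x + N * b * y + c * z + d * w) ^ 2
      = N ^ 2 * (a * y - b * x) ^ 2 + N * ((a * z - c * x) ^ 2 + (a * w - d * x) ^ 2
        + (b * z - c * y) ^ 2 + (b * w - d * y) ^ 2) + (c * w - d * z) ^ 2 := by ring
  have : 0 ≤ N ^ 2 * (a * y - b * x) ^ 2 + N * ((a * z - c * x) ^ 2 + (a * w - d * x) ^ 2
        + (b * z - c * y) ^ 2 + (b * w - d * y) ^ 2) + (c * w - d * z) ^ 2 := by positivity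
  linarith

/-- An orthogonal `2 × 2` matrix acts on the centered parts of `z` and `w`, and the mean parts go to
the direction that separates facts from implications. -/
lemma sum_sq_isotypic_le (hn : 0 < n) {c s ε : ℝ} (hcs : c ^ 2 + s ^ 2 = 1) (hε : ε ^ 2 = 1)
    {η₁ η₂ η₃ η₄ : ℝ} (hη : 2 * (n : ℝ) * (n * (η₁ ^ 2 + η₂ ^ 2) + (η₃ ^ 2 + η₄ ^ 2)) ≤ 1)
    (z w : Fin n → ℝ) (v₁ v₂ t : ℝ)
    (ht : t = η₁ * ∑ k, z k + η₂ * ∑ k, w k + η₃ * v₁ + η₄ * v₂) :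
    ∑ i, (c * (z i - (∑ k, z k) / n) - ε * s * (w i - (∑ k, w k) / n) + t) ^ 2
      + ∑ i, (s * (z i - (∑ k, z k) / n) + ε * c * (w i - (∑ k, w k) / n) - t) ^ 2
      ≤ ∑ i, z i ^ 2 + ∑ i, w i ^ 2 + v₁ ^ 2 + v₂ ^ 2 := by
  have hn0 : (0 : ℝ) < n := by exact_mod_cast hn
  set x := (∑ k, z k) / n with hx
  set y := (∑ k, w k) / n with hy
  have hz : ∑ k, z k = n * x := by rw [hx]; field_simp
  have hw : ∑ k, w k = n * y := by rw [hy]; field_simp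
  rw [hz, hw] at ht
  -- Orthogonality kills the products of the two deviations; the terms linear in `t` cancel only
  -- after summing over `i`, since deviations have mean zero.
  have hterm : ∀ i, (c * (z i - x) - ε * s * (w i - y) + t) ^ 2
      + (s * (z i - x) + ε * c * (w i - y) - t) ^ 2
      = z i ^ 2 + w i ^ 2 + (2 * t * (c - s) - 2 * x) * z i + (-2 * t * ε * (s + c) - 2 * y) * w i
        + (x ^ 2 + y ^ 2 + 2 * t ^ 2 - 2 * t * (c - s) * x + 2 * t * ε * (s + c) * y) := fun i => by
    linear_combination ((z i - x) ^ 2 + ε ^ 2 * (w i - y) ^ 2) * hcs + (w i - y) ^ 2 * hε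
  rw [← Finset.sum_add_distrib, Finset.sum_congr rfl fun i _ => hterm i]
  simp only [Finset.sum_add_distrib, ← Finset.mul_sum, hz, hw, Finset.sum_const, Finset.card_univ,
    Fintype.card_fin, nsmul_eq_mul]
  have h1 := weighted_cauchy hn0.le η₁ η₂ η₃ η₄ x y v₁ v₂
  have h2 : t = n * η₁ * x + n * η₂ * y + η₃ * v₁ + η₄ * v₂ := by rw [ht]; ring
  rw [← h2] at h1
  have h3 : 0 ≤ n * (x ^ 2 + y ^ 2) + (v₁ ^ 2 + v₂ ^ 2) := by positivity
  have h4 := mul_le_mul_of_nonneg_right hη h3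
  have h5 := mul_le_mul_of_nonneg_left h1 (by positivity : 0 ≤ 2 * (n : ℝ))
  linarith

/-- The dual certificate built from the orthogonal matrix with columns `(c, s)` and
`ε • (-s, c)`, and from the weights `η` on the direction separating facts from implications. -/
noncomputable def certificate (n mtrain mtest : ℕ) (a b c s ε η₁ η₂ η₃ η₄ : ℝ) :
    OVMatrix n mtrain mtest
  | .ans (.b i), .subj (k, .inl _) => (c * centering n i k + η₁) / a
  | .ans (.c i), .subj (k, .inl _) => (s * centering n i k - η₁) / a
  | .ans (.b i), .subj (k, .inr _) => (-(ε * s) * centering n i k + η₂) / b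
  | .ans (.c i), .subj (k, .inr _) => (ε * c * centering n i k - η₂) / b
  | .ans (.b _), .rel .r₁ => η₃
  | .ans (.c _), .rel .r₁ => -η₃
  | .ans (.b _), .rel .r₂ => η₄
  | .ans (.c _), .rel .r₂ => -η₄
  | _, _ => 0

/-- The matrix sees the subjects of a class only through their sums divided by `a` or `b`; by
Cauchy–Schwarz this compression does not increase the norm, and `sum_sq_isotypic_le` handles the
rest. -/
lemma isContraction_certificate (hn : 0 < n) {a b c s ε η₁ η₂ η₃ η₄ : ℝ} (ha : 0 < a) (hb : 0 < b)
    (ha2 : a ^ 2 = mtrain) (hb2 : b ^ 2 = mtest) (hcs : c ^ 2 + s ^ 2 = 1) (hε : ε ^ 2 = 1)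
    (hη : 2 * (n : ℝ) * (n * (η₁ ^ 2 + η₂ ^ 2) + (η₃ ^ 2 + η₄ ^ 2)) ≤ 1) :
    IsContraction (certificate n mtrain mtest a b c s ε η₁ η₂ η₃ η₄) := by
  intro v
  set Y := certificate n mtrain mtest a b c s ε η₁ η₂ η₃ η₄
  let z : Fin n → ℝ := fun k => (∑ j, v (.subj (k, .inl j))) / a
  let w : Fin n → ℝ := fun k => (∑ j, v (.subj (k, .inr j))) / b
  let v₁ := v (.rel .r₁)
  let v₂ := v (.rel .r₂)
  have hrow : ∀ (ζ ξ μ ν : ℝ) (i : Fin n),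
      ∑ k, (∑ j, (ζ * centering n i k + μ) / a * v (.subj (k, .inl j))
        + ∑ j, (ξ * centering n i k + ν) / b * v (.subj (k, .inr j)))
      = ζ * (z i - (∑ k, z k) / n) + ξ * (w i - (∑ k, w k) / n)
        + (μ * ∑ k, z k + ν * ∑ k, w k) := fun ζ ξ μ ν i => by
    rw [← sum_centering_mul, ← sum_centering_mul]
    simp only [Finset.mul_sum, ← Finset.sum_add_distrib]
    refine Finset.sum_congr rfl fun k _ => ?_
    simp only [← Finset.mul_sum, z, w]
    ring
  have hb' : ∀ i, (Y *ᵥ v) (.ans (.b i)) = c * (z i - (∑ k, z k) / n)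
      - ε * s * (w i - (∑ k, w k) / n)
      + (η₁ * ∑ k, z k + η₂ * ∑ k, w k + η₃ * v₁ + η₄ * v₂) := fun i => by
    rw [Matrix.mulVec, dotProduct, sum_token, sum_subject, sum_relation]
    simp only [Y, certificate, zero_mul, Finset.sum_const_zero, add_zero]
    rw [hrow]
    ring
  have hc' : ∀ i, (Y *ᵥ v) (.ans (.c i)) = s * (z i - (∑ k, z k) / n)
      + ε * c * (w i - (∑ k, w k) / n)
      - (η₁ * ∑ k, z k + η₂ * ∑ k, w k + η₃ * v₁ + η₄ * v₂) := fun i => by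
    rw [Matrix.mulVec, dotProduct, sum_token, sum_subject, sum_relation]
    simp only [Y, certificate, zero_mul, Finset.sum_const_zero, add_zero, sub_eq_add_neg]
    rw [hrow]
    ring
  have h0 : (∀ q, (Y *ᵥ v) (.subj q) = 0) ∧ (∀ r, (Y *ᵥ v) (.rel r) = 0) ∧
      (Y *ᵥ v) .eos = 0 := by
    refine ⟨fun q => ?_, fun r => ?_, ?_⟩ <;>
      simp [Matrix.mulVec, dotProduct, Y, certificate]
  have hz : ∀ k, z k ^ 2 ≤ ∑ j, v (.subj (k, .inl j)) ^ 2 := fun k => by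
    have := sq_sum_le_card_mul_sum_sq (s := (Finset.univ : Finset (Fin mtrain)))
      (f := fun j => v (.subj (k, .inl j)))
    rw [div_pow, div_le_iff₀ (by positivity), ha2, mul_comm]
    simpa using this
  have hw : ∀ k, w k ^ 2 ≤ ∑ j, v (.subj (k, .inr j)) ^ 2 := fun k => by
    have := sq_sum_le_card_mul_sum_sq (s := (Finset.univ : Finset (Fin mtest)))
      (f := fun j => v (.subj (k, .inr j)))
    rw [div_pow, div_le_iff₀ (by positivity), hb2, mul_comm]
    simpa using this
  have hmain := sum_sq_isotypic_le hn hcs hε hη z w v₁ v₂ _ rfl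
  rw [dotProduct, dotProduct, sum_token, sum_token, sum_answer, sum_subject
    (fun q => v (.subj q) * v (.subj q)), sum_relation (fun r => v (.rel r) * v (.rel r))]
  simp only [h0.1, h0.2.1, h0.2.2, hb', hc', mul_zero, Finset.sum_const_zero, zero_add, add_zero]
  simp only [← sq]
  refine hmain.trans ?_
  have h1 := Finset.sum_le_sum fun k (_ : k ∈ Finset.univ) => hz k
  have h2 := Finset.sum_le_sum fun k (_ : k ∈ Finset.univ) => hw k
  have h3 : 0 ≤ ∑ q : Answer n, v (.ans q) ^ 2 := Finset.sum_nonneg fun _ _ => sq_nonneg _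
  have h4 : 0 ≤ v .eos ^ 2 := sq_nonneg _
  rw [Finset.sum_add_distrib]
  linarith

lemma sum_sum_centering_mul (hn : 0 < n) (ζ μ x y : ℝ) :
    ∑ i : Fin n, ∑ k : Fin n, (ζ * centering n i k + μ)
      * (x * (1 : Matrix (Fin n) (Fin n) ℝ) i k + y) = (n - 1) * ζ * x + n * μ * (x + n * y) := by
  have hn0 : (n : ℝ) ≠ 0 := by exact_mod_cast hn.ne'
  have h : ∀ i k : Fin n, (ζ * centering n i k + μ) * (x * (1 : Matrix (Fin n) (Fin n) ℝ) i k + y)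
      = (ζ * x - ζ * (n : ℝ)⁻¹ * x + μ * x + ζ * y) * (1 : Matrix (Fin n) (Fin n) ℝ) i k
        + (μ * y - ζ * (n : ℝ)⁻¹ * y) := fun i k => by
    rw [centering_apply]
    rcases eq_or_ne i k with rfl | hik
    · rw [Matrix.one_apply_eq]; ring
    · rw [Matrix.one_apply_ne hik]; ring
  simp only [h]
  simp only [Finset.sum_add_distrib, ← Finset.mul_sum, Matrix.one_apply, Finset.sum_ite_eq,
    Finset.mem_univ, if_true, Finset.sum_const, Finset.card_univ, Fintype.card_fin, nsmul_eq_mul]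
  field_simp
  ring

lemma pairing_certificate (hn : 0 < n) {a b : ℝ} (ha : 0 < a) (hb : 0 < b)
    (ha2 : a ^ 2 = mtrain) (hb2 : b ^ 2 = mtest) (c s ε η₁ η₂ η₃ η₄ : ℝ)
    {W : OVMatrix n mtrain mtest} {p₁ p₂ q₁ q₂ f₁ f₂ g₁ g₂ β₁ β₂ γ₁ γ₂ : ℝ}
    (hp : ∀ i k j, W (.ans (.b i)) (.subj (k, .inl j))
      = p₁ * (1 : Matrix (Fin n) (Fin n) ℝ) i k + p₂)
    (hq : ∀ i k j, W (.ans (.c i)) (.subj (k, .inl j))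
      = q₁ * (1 : Matrix (Fin n) (Fin n) ℝ) i k + q₂)
    (hf : ∀ i k j, W (.ans (.b i)) (.subj (k, .inr j))
      = f₁ * (1 : Matrix (Fin n) (Fin n) ℝ) i k + f₂)
    (hg : ∀ i k j, W (.ans (.c i)) (.subj (k, .inr j))
      = g₁ * (1 : Matrix (Fin n) (Fin n) ℝ) i k + g₂)
    (hβ₁ : ∀ i, W (.ans (.b i)) (.rel .r₁) = β₁) (hβ₂ : ∀ i, W (.ans (.b i)) (.rel .r₂) = β₂)
    (hγ₁ : ∀ i, W (.ans (.c i)) (.rel .r₁) = γ₁) (hγ₂ : ∀ i, W (.ans (.c i)) (.rel .r₂) = γ₂) :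
    pairing (certificate n mtrain mtest a b c s ε η₁ η₂ η₃ η₄) W
      = (n - 1) * (c * (a * p₁ + ε * (b * g₁)) + s * (a * q₁ - ε * (b * f₁)))
        + n * (a * η₁ * (p₁ + n * p₂ - (q₁ + n * q₂)) + b * η₂ * (f₁ + n * f₂ - (g₁ + n * g₂))
          + η₃ * (β₁ - γ₁) + η₄ * (β₂ - γ₂)) := by
  have htr : ∀ ζ μ x y : ℝ, ∑ i : Fin n, ∑ k : Fin n, ∑ _j : Fin mtrain,
      (ζ * centering n i k + μ) / a * (x * (1 : Matrix (Fin n) (Fin n) ℝ) i k + y)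
      = a * ((n - 1) * ζ * x + n * μ * (x + n * y)) := fun ζ μ x y => by
    rw [← sum_sum_centering_mul hn, Finset.mul_sum]
    refine Finset.sum_congr rfl fun i _ => ?_
    rw [Finset.mul_sum]
    refine Finset.sum_congr rfl fun k _ => ?_
    rw [Finset.sum_const, Finset.card_univ, Fintype.card_fin, nsmul_eq_mul, ← ha2]
    field_simp
  have hte : ∀ ζ μ x y : ℝ, ∑ i : Fin n, ∑ k : Fin n, ∑ _j : Fin mtest,
      (ζ * centering n i k + μ) / b * (x * (1 : Matrix (Fin n) (Fin n) ℝ) i k + y)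
      = b * ((n - 1) * ζ * x + n * μ * (x + n * y)) := fun ζ μ x y => by
    rw [← sum_sum_centering_mul hn, Finset.mul_sum]
    refine Finset.sum_congr rfl fun i _ => ?_
    rw [Finset.mul_sum]
    refine Finset.sum_congr rfl fun k _ => ?_
    rw [Finset.sum_const, Finset.card_univ, Fintype.card_fin, nsmul_eq_mul, ← hb2]
    field_simp
  rw [pairing, sum_token, sum_answer]
  simp only [sum_token, sum_subject, sum_relation, certificate, hp, hq, hf, hg, hβ₁, hβ₂, hγ₁, hγ₂,
    zero_mul, Finset.sum_const_zero, add_zero, zero_add, sub_eq_add_neg (_ * centering n _ _),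
    Finset.sum_add_distrib]
  simp only [htr, hte]
  simp only [Finset.sum_const, Finset.card_univ, Fintype.card_fin, nsmul_eq_mul]
  ring

end Certificate

/-! ### The 2×2 optimization problem. -/

section Numerics

lemma sq_add_sq_le_of_forall_unit {m K u v : ℝ} (hm : 0 ≤ m)
    (h : ∀ c s : ℝ, c ^ 2 + s ^ 2 = 1 → m * (c * u + s * v) ≤ K) :
    0 ≤ K ∧ m ^ 2 * (u ^ 2 + v ^ 2) ≤ K ^ 2 := by
  have h0 : 0 ≤ K := by
    have h1 := h 1 0 (by norm_num)
    have h2 := h (-1) 0 (by norm_num)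
    linarith
  refine ⟨h0, ?_⟩
  rcases (add_nonneg (sq_nonneg u) (sq_nonneg v)).eq_or_lt with hr | hr
  · rw [← hr, mul_zero]; positivity
  · have hS := Real.sqrt_pos.2 hr
    have hS2 := Real.sq_sqrt hr.le
    set S := Real.sqrt (u ^ 2 + v ^ 2)
    have h1 := h (u / S) (v / S) (by field_simp; linarith)
    have h2 : u / S * u + v / S * v = S := by field_simp; linarith
    rw [h2] at h1
    calc m ^ 2 * (u ^ 2 + v ^ 2) = (m * S) ^ 2 := by rw [mul_pow, hS2]
      _ ≤ K ^ 2 := pow_le_pow_left₀ (by positivity) h1 2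

/-- The minimal nuclear norm of `!![a * p, b * f; a * q, b * g]` subject to `1 ≤ p, q, f`. -/
noncomputable def blockOptimum (a b : ℝ) : ℝ := if a ≤ b then a + b else Real.sqrt (2 * (a ^ 2 + b ^ 2))

/-- The squared nuclear norm of a 2×2 matrix is the larger of the two sums of squares in `h₁`, `h₂`.
If `a ≤ b`, then `h₂` alone is tight and forces `a * p = b * g`; otherwise a convex combination of
both forces `g = p = 1`. -/
lemma block_minimizer {a b p q f g m K : ℝ} (ha : 0 < a) (hb : 0 < b) (hm : 0 < m)
    (hp : 1 ≤ p) (hq : 1 ≤ q) (hf : 1 ≤ f) (hK0 : 0 ≤ K)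
    (h₁ : m ^ 2 * ((a * p + b * g) ^ 2 + (a * q - b * f) ^ 2) ≤ K ^ 2)
    (h₂ : m ^ 2 * ((a * p - b * g) ^ 2 + (a * q + b * f) ^ 2) ≤ K ^ 2)
    (hK : K ≤ m * blockOptimum a b) :
    f = 1 ∧ min (a / b) 1 ≤ g ∧ m * blockOptimum a b ≤ K := by
  have hm2 : 0 < m ^ 2 := by positivity
  unfold blockOptimum at hK ⊢
  split_ifs at hK ⊢ with hab
  · have hKs : K ^ 2 ≤ m ^ 2 * (a + b) ^ 2 := by
      rw [← mul_pow]; exact pow_le_pow_left₀ hK0 hK 2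
    have h3 : (a * p - b * g) ^ 2 + (a * q + b * f) ^ 2 ≤ (a + b) ^ 2 :=
      le_of_mul_le_mul_left (h₂.trans hKs) hm2
    have haq : a ≤ a * q := le_mul_of_one_le_right ha.le hq
    have hbf : b ≤ b * f := le_mul_of_one_le_right hb.le hf
    have h4 : (a + b) ^ 2 ≤ (a * q + b * f) ^ 2 := pow_le_pow_left₀ (by positivity) (by linarith) 2
    have h5 : a * q + b * f ≤ a + b :=
      le_of_sq_le_sq (by nlinarith [sq_nonneg (a * p - b * g)]) (by positivity)
    have h6 : a * p - b * g = 0 := by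
      refine pow_eq_zero_iff two_ne_zero |>.1 (le_antisymm (by linarith) (sq_nonneg _))
    refine ⟨mul_left_cancel₀ hb.ne' (by linarith), (min_le_left _ _).trans ?_, ?_⟩
    · rw [div_le_iff₀ hb]
      nlinarith
    · refine le_of_sq_le_sq ?_ hK0
      rw [mul_pow]
      exact (mul_le_mul_of_nonneg_left (h4.trans (by nlinarith [sq_nonneg (a * p - b * g)]))
        hm2.le).trans h₂
  · push Not at hab
    have hS2 := Real.sq_sqrt (by positivity : 0 ≤ 2 * (a ^ 2 + b ^ 2))
    have hKs : K ^ 2 ≤ m ^ 2 * (2 * (a ^ 2 + b ^ 2)) := by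
      rw [← hS2, ← mul_pow]; exact pow_le_pow_left₀ hK0 hK 2
    have hconv : m ^ 2 * (b ^ 2 * (g - p) ^ 2 + (a ^ 2 - b ^ 2) * p ^ 2 + a ^ 2 * q ^ 2
        + b ^ 2 * f ^ 2 + 2 * b ^ 2 * (f * q)) ≤ K ^ 2 := by
      -- The weights `(a ± b) / (2 * a)` are chosen so that the `p * g` term completes the square
      -- `b² (g - p)²`.
      have e : a * (m ^ 2 * (b ^ 2 * (g - p) ^ 2 + (a ^ 2 - b ^ 2) * p ^ 2 + a ^ 2 * q ^ 2
          + b ^ 2 * f ^ 2 + 2 * b ^ 2 * (f * q)))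
          = (a + b) / 2 * (m ^ 2 * ((a * p - b * g) ^ 2 + (a * q + b * f) ^ 2))
          + (a - b) / 2 * (m ^ 2 * ((a * p + b * g) ^ 2 + (a * q - b * f) ^ 2)) := by ring
      refine le_of_mul_le_mul_left ?_ ha
      rw [e]
      have i1 := mul_le_mul_of_nonneg_left h₂ (by linarith : 0 ≤ (a + b) / 2)
      have i2 := mul_le_mul_of_nonneg_left h₁ (by linarith : 0 ≤ (a - b) / 2)
      linarith
    have hd : 0 < a ^ 2 - b ^ 2 := by nlinarith
    have hp2 : (a ^ 2 - b ^ 2) * 1 ≤ (a ^ 2 - b ^ 2) * p ^ 2 :=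
      mul_le_mul_of_nonneg_left (one_le_pow₀ hp) hd.le
    have hq2 : a ^ 2 * 1 ≤ a ^ 2 * q ^ 2 := mul_le_mul_of_nonneg_left (one_le_pow₀ hq) (by positivity)
    have hf2 : b ^ 2 * 1 ≤ b ^ 2 * f ^ 2 := mul_le_mul_of_nonneg_left (one_le_pow₀ hf) (by positivity)
    have hfq : 2 * b ^ 2 * 1 ≤ 2 * b ^ 2 * (f * q) :=
      mul_le_mul_of_nonneg_left (by nlinarith) (by positivity)
    have hg2 : 0 ≤ b ^ 2 * (g - p) ^ 2 := by positivity
    have h3 := le_of_mul_le_mul_left (hconv.trans hKs) hm2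
    have hp1 : p = 1 := by
      have : p ^ 2 ≤ 1 := le_of_mul_le_mul_left (by linarith) hd
      nlinarith
    have hf1 : f = 1 := by
      have : f ^ 2 ≤ 1 := le_of_mul_le_mul_left (by linarith) (by positivity : 0 < b ^ 2)
      nlinarith
    have hg1 : g - p = 0 := by
      have : (g - p) ^ 2 ≤ 0 :=
        le_of_mul_le_mul_left (by linarith) (by positivity : 0 < b ^ 2)
      exact pow_eq_zero_iff two_ne_zero |>.1 (le_antisymm this (sq_nonneg _))
    refine ⟨hf1, (min_le_right _ _).trans (by linarith), le_of_sq_le_sq ?_ hK0⟩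
    rw [mul_pow, hS2]
    exact (mul_le_mul_of_nonneg_left (by linarith) hm2.le).trans hconv

/-- The optimal matrix is `!![a, b; a, a]` when `a ≤ b`, and the rank-one `!![a, b; a, b]`
otherwise; the factors are balanced to have equal Frobenius norm. -/
lemma exists_block_factorization {a b : ℝ} (ha : 0 < a) (hb : 0 < b) :
    ∃ A₁ A₂ B₁ B₂ : Fin 2 → ℝ, A₁ ⬝ᵥ B₁ = a ∧ A₁ ⬝ᵥ B₂ = b ∧ A₂ ⬝ᵥ B₁ = a ∧
      A₂ ⬝ᵥ B₂ = b * min (a / b) 1 ∧ A₁ ⬝ᵥ A₁ + A₂ ⬝ᵥ A₂ = blockOptimum a b ∧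
      B₁ ⬝ᵥ B₁ + B₂ ⬝ᵥ B₂ = blockOptimum a b := by
  unfold blockOptimum
  split_ifs with hab
  · have h1 := Real.mul_self_sqrt ha.le
    have h2 := Real.mul_self_sqrt (sub_nonneg.2 hab)
    have h3 : b * min (a / b) 1 = a := by
      rw [min_eq_left ((div_le_one hb).2 hab)]; field_simp
    refine ⟨![√a, √(b - a)], ![√a, 0], ![√a, 0], ![√a, √(b - a)], ?_⟩
    simp only [dotProduct, Fin.sum_univ_two, Matrix.cons_val_zero, Matrix.cons_val_one, h1, h2, h3, mul_zero, zero_mul]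
    refine ⟨?_, ?_, ?_, ?_, ?_, ?_⟩ <;> ring
  · push Not at hab
    have hN : 0 < √(2 * (a ^ 2 + b ^ 2)) := Real.sqrt_pos.2 (by positivity)
    have hN2 := Real.mul_self_sqrt (by positivity : 0 ≤ 2 * (a ^ 2 + b ^ 2))
    set N := √(2 * (a ^ 2 + b ^ 2))
    have hT : 0 < √(N / 2) := Real.sqrt_pos.2 (by positivity)
    have hT2 := Real.mul_self_sqrt (by positivity : 0 ≤ N / 2)
    set T := √(N / 2)
    have h3 : b * min (a / b) 1 = b := by
      rw [min_eq_right ((one_le_div hb).2 hab.le), mul_one]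
    have h4 : a / T * (a / T) + b / T * (b / T) = N := by
      have : a / T * (a / T) + b / T * (b / T) = (a ^ 2 + b ^ 2) / (T * T) := by field_simp
      rw [this, hT2, div_eq_iff (by positivity)]
      linarith
    refine ⟨![T, 0], ![T, 0], ![a / T, 0], ![b / T, 0], ?_⟩
    simp only [dotProduct, Fin.sum_univ_two, Matrix.cons_val_zero, Matrix.cons_val_one, h3, mul_zero, add_zero,
      hT2, h4]
    exact ⟨by field_simp, by field_simp, by field_simp, by field_simp, by ring, trivial⟩

end Numerics

/-! ### Uniqueness and symmetry for the Frobenius problem. -/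

section Frobenius

variable {n mtrain mtest : ℕ}

lemma frobeniusNorm_sq {ρ κ : Type*} [Fintype ρ] [Fintype κ] (M : Matrix ρ κ ℝ) :
    frobeniusNorm M ^ 2 = ∑ i, ∑ j, M i j ^ 2 := by
  rw [frobeniusNorm, Matrix.frobenius_norm_def, ← Real.rpow_natCast, ← Real.rpow_mul]
  · simp
  · positivity

/-- The Frobenius-norm SVM has at most one solution. -/
lemma IsFrobeniusSVMSolution.eq_of_le {W W' : OVMatrix n mtrain mtest}
    (hW : IsFrobeniusSVMSolution W) (hW' : W' ∈ feasibleSet n mtrain mtest)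
    (hle : ∑ x, ∑ y, W' x y ^ 2 ≤ ∑ x, ∑ y, W x y ^ 2) : W' = W := by
  have hmem : (1 / 2 : ℝ) • (W + W') ∈ feasibleSet n mtrain mtest := fun s r hsr a' ha' => by
    have h1 := hW.1 s r hsr a' ha'
    have h2 := hW' s r hsr a' ha'
    simp only [margin, logit, Matrix.smul_apply, Matrix.add_apply, smul_eq_mul] at h1 h2 ⊢
    linarith
  have h := hW.2 hmem
  simp only [Set.mem_ofPred_eq, frobeniusNorm_sq] at h
  -- Parallelogram law: the feasible midpoint cannot have smaller norm than `W`, so the difference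
  -- vanishes.
  have hsum : ∑ x, ∑ y, (W' x y - W x y) ^ 2 = 2 * (∑ x, ∑ y, W x y ^ 2)
      + 2 * (∑ x, ∑ y, W' x y ^ 2)
      - 4 * ∑ x, ∑ y, ((1 / 2 : ℝ) • (W + W')) x y ^ 2 := by
    simp only [Finset.mul_sum, ← Finset.sum_add_distrib, ← Finset.sum_sub_distrib]
    refine Finset.sum_congr rfl fun x _ => Finset.sum_congr rfl fun y _ => ?_
    simp only [Matrix.smul_apply, Matrix.add_apply, smul_eq_mul]
    ring
  have h0 : ∑ x, ∑ y, (W' x y - W x y) ^ 2 = 0 :=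
    le_antisymm (by linarith)
      (Finset.sum_nonneg fun x _ => Finset.sum_nonneg fun y _ => sq_nonneg _)
  ext x y
  have h1 := (Finset.sum_eq_zero_iff_of_nonneg
    (fun x _ => Finset.sum_nonneg fun y _ => sq_nonneg _)).1 h0 x (Finset.mem_univ _)
  have h2 := (Finset.sum_eq_zero_iff_of_nonneg (fun y _ => sq_nonneg _)).1 h1 y (Finset.mem_univ _)
  exact sub_eq_zero.1 (pow_eq_zero_iff two_ne_zero |>.1 h2)

/-- The action on answers of a permutation of the classes. -/
def permAnswer (σ : Fin n ≃ Fin n) : Answer n → Answer n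
  | .b i => .b (σ i)
  | .c i => .c (σ i)

/-- The action on tokens of a permutation of the classes. -/
def permToken (σ : Fin n ≃ Fin n) : Token n mtrain mtest → Token n mtrain mtest
  | .subj s => .subj (σ s.1, s.2)
  | .rel r => .rel r
  | .ans a => .ans (permAnswer σ a)
  | .eos => .eos

lemma permToken_symm (σ : Fin n ≃ Fin n) (x : Token n mtrain mtest) :
    permToken σ.symm (permToken σ x) = x := by
  rcases x with s | r | (i | i) | _ <;> simp [permToken, permAnswer]

/-- The permutation of the tokens induced by a permutation of the classes. -/
def permTokenEquiv (σ : Fin n ≃ Fin n) : Token n mtrain mtest ≃ Token n mtrain mtest where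
  toFun := permToken σ
  invFun := permToken σ.symm
  left_inv := permToken_symm σ
  right_inv := permToken_symm σ.symm

lemma IsFrobeniusSVMSolution.submatrix_permToken {W : OVMatrix n mtrain mtest}
    (hW : IsFrobeniusSVMSolution W) (σ : Fin n ≃ Fin n) :
    W.submatrix (permToken σ) (permToken σ) = W := by
  refine hW.eq_of_le (fun s r hsr a' ha' => ?_) (le_of_eq ?_)
  · have h := hW.1 (σ s.1, s.2) r (by simpa [trainPairs, trainSubjects, testSubjects] using hsr)
      (permAnswer σ a') (by
        cases r <;> cases a' <;> simp_all [correctAnswer, permAnswer])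
    cases r <;> simpa [margin, logit, permToken, permAnswer, correctAnswer] using h
  · rw [← (permTokenEquiv σ).sum_comp fun x => ∑ y, W x y ^ 2]
    refine Finset.sum_congr rfl fun x _ => ?_
    rw [← (permTokenEquiv σ).sum_comp fun y => W _ y ^ 2]
    rfl

lemma IsFrobeniusSVMSolution.apply_rel {W : OVMatrix n mtrain mtest}
    (hW : IsFrobeniusSVMSolution W) (i k : Fin n) (r : Relation) :
    W (.ans (.c i)) (.rel r) = W (.ans (.c k)) (.rel r) := by
  have h := congrFun (congrFun (hW.submatrix_permToken (Equiv.swap i k)) (.ans (.c k))) (.rel r)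
  simpa [permToken, permAnswer] using h

lemma IsFrobeniusSVMSolution.apply_testSubject {W : OVMatrix n mtrain mtest}
    (hW : IsFrobeniusSVMSolution W) (i k l : Fin n) (j : Fin mtest) :
    W (.ans (.c i)) (.subj (l, .inr j)) = W (.ans (.c k)) (.subj (l, .inr j)) := by
  let y₀ : Token n mtrain mtest := .subj (l, .inr j)
  let e : Token n mtrain mtest ≃ Token n mtrain mtest := Equiv.swap (.ans (.c i)) (.ans (.c k))
  let W' : OVMatrix n mtrain mtest := fun x y => if y = y₀ then W (e x) y else W x y
  have heq : W' = W := by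
    refine hW.eq_of_le (fun s r hsr a' ha' => ?_) (le_of_eq ?_)
    · by_cases hs : s = (l, .inr j)
      · subst hs
        have hr : r = .r₁ := by
          simpa [trainPairs, trainSubjects, testSubjects] using hsr
        subst hr
        have hb : ∀ m, e (.ans (.b m)) = .ans (.b m) := fun m =>
          Equiv.swap_apply_of_ne_of_ne (by simp) (by simp)
        rcases a' with m | m
        · simpa [margin, logit, correctAnswer, W', y₀, hb] using hW.1 _ _ hsr _ ha'
        · obtain ⟨m', hm'⟩ : ∃ m', e (.ans (.c m)) = .ans (.c m') := by
            simp only [e, Equiv.swap_apply_def]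
            split_ifs <;> exact ⟨_, rfl⟩
          have h := hW.1 (l, .inr j) .r₁ hsr (.c m') (by simp [correctAnswer])
          -- The relation entries of `c m'` and `c m` agree, so the exchange affects only the
          -- subject entry of the logit.
          rw [margin, logit, logit, hW.apply_rel m' m] at h
          simpa [margin, logit, correctAnswer, W', y₀, hb, hm'] using h
      · have hs' : (Token.subj s : Token n mtrain mtest) ≠ y₀ := by simpa [y₀] using hs
        have hr' : (Token.rel r : Token n mtrain mtest) ≠ y₀ := by simp [y₀]
        simpa [margin, logit, W', hs', hr'] using hW.1 s r hsr a' ha'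
    · rw [Finset.sum_comm, Finset.sum_comm (f := fun x y => W x y ^ 2)]
      refine Finset.sum_congr rfl fun y _ => ?_
      by_cases hy : y = y₀
      · simp only [W', hy, if_true]
        exact e.sum_comp fun x => W x y₀ ^ 2
      · simp [W', hy]
  have h := congrFun (congrFun heq (.ans (.c k))) y₀
  simpa [W', e, y₀] using h

theorem IsFrobeniusSVMSolution.margin_eq_zero {W : OVMatrix n mtrain mtest}
    (hW : IsFrobeniusSVMSolution W) {s : Subject n mtrain mtest} {r : Relation}
    (hsr : (s, r) ∈ testPairs n mtrain mtest) {a' : Answer n} (ha' : a' ∈ implicationAnswers n) :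
    margin W s r a' = 0 := by
  obtain ⟨k, rfl⟩ := ha'
  obtain ⟨l, j | j⟩ := s
  · simp [testPairs, testSubjects] at hsr
  · have hr : r = .r₂ := by simpa [testPairs, testSubjects] using hsr
    subst hr
    rw [margin, logit, logit, correctAnswer, hW.apply_rel l k, hW.apply_testSubject l k, sub_self]

end Frobenius

/-! ### A feasible matrix attaining the dual lower bound. -/

section Optimum

variable {n mtrain mtest : ℕ}

lemma centering_symm (i k : Fin n) : centering n i k = centering n k i := by
  simp only [centering_apply, Matrix.one_apply, eq_comm]

/-- The centering matrix is a symmetric projection, so both factors of the optimum can carry it. -/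
lemma sum_centering_mul_centering (hn : 0 < n) (i k : Fin n) :
    ∑ l, centering n i l * centering n k l = centering n i k := by
  have hn0 : (n : ℝ) ≠ 0 := by exact_mod_cast hn.ne'
  rw [sum_centering_mul]
  have h : ∑ l, centering n k l = 0 := by
    have := sum_centering_mul k fun _ => 1
    simp only [mul_one, Finset.sum_const, Finset.card_univ, Fintype.card_fin, nsmul_eq_mul] at this
    rw [this, div_self hn0, sub_self]
  rw [h, zero_div, sub_zero, centering_symm]

lemma sum_sum_centering_sq (hn : 0 < n) :
    ∑ i : Fin n, ∑ l, centering n i l ^ 2 = n - 1 := by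
  have hn0 : (n : ℝ) ≠ 0 := by exact_mod_cast hn.ne'
  simp only [sq, sum_centering_mul_centering hn]
  simp only [centering_apply, Matrix.one_apply_eq,
    Finset.sum_const, Finset.card_univ, Fintype.card_fin, nsmul_eq_mul]
  field_simp

/-- The left factor of the optimal matrix. -/
noncomputable def optimumLeft (n mtrain mtest : ℕ) (A₁ A₂ : Fin 2 → ℝ) (α : ℝ) :
    Matrix (Token n mtrain mtest) (Fin n × Fin 2 ⊕ Unit) ℝ
  | .ans (.b i), .inl (k, l) => centering n i k * A₁ l
  | .ans (.c i), .inl (k, l) => centering n i k * A₂ l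
  | .ans (.b _), .inr _ => α
  | .ans (.c _), .inr _ => -α
  | _, _ => 0

/-- The right factor of the optimal matrix. -/
noncomputable def optimumRight (n mtrain mtest : ℕ) (B₁ B₂ : Fin 2 → ℝ) (a b τ : ℝ) :
    Matrix (Token n mtrain mtest) (Fin n × Fin 2 ⊕ Unit) ℝ
  | .subj (i, .inl _), .inl (k, l) => centering n i k * B₁ l / a
  | .subj (i, .inr _), .inl (k, l) => centering n i k * B₂ l / b
  | .rel .r₁, .inr _ => τ
  | .rel .r₂, .inr _ => -τ
  | _, _ => 0

lemma sum_prod_centering (hn : 0 < n) (i k : Fin n) (A B : Fin 2 → ℝ) (d : ℝ) :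
    ∑ q : Fin n × Fin 2, centering n i q.1 * A q.2 * (centering n k q.1 * B q.2 / d)
      = (A ⬝ᵥ B) / d * centering n i k := by
  rw [Fintype.sum_prod_type, ← sum_centering_mul_centering hn i k, Finset.mul_sum]
  refine Finset.sum_congr rfl fun x _ => ?_
  rw [dotProduct, Finset.sum_div, Finset.sum_mul]
  exact Finset.sum_congr rfl fun y _ => by ring

lemma sum_sq_prod_centering (hn : 0 < n) (A : Fin 2 → ℝ) :
    ∑ i : Fin n, ∑ q : Fin n × Fin 2, (centering n i q.1 * A q.2) ^ 2
      = (n - 1) * (A ⬝ᵥ A) := by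
  rw [← sum_sum_centering_sq hn, Finset.sum_mul]
  refine Finset.sum_congr rfl fun i _ => ?_
  rw [Fintype.sum_prod_type, Finset.sum_mul]
  refine Finset.sum_congr rfl fun x _ => ?_
  rw [dotProduct, Finset.mul_sum]
  exact Finset.sum_congr rfl fun y _ => by ring

lemma sum_sq_optimumLeft (hn : 0 < n) (A₁ A₂ : Fin 2 → ℝ) (α : ℝ) :
    ∑ x, ∑ l, optimumLeft n mtrain mtest A₁ A₂ α x l ^ 2
      = (n - 1) * (A₁ ⬝ᵥ A₁ + A₂ ⬝ᵥ A₂) + 2 * n * α ^ 2 := by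
  rw [sum_token, sum_answer]
  simp only [Fintype.sum_sum_type, optimumLeft, ne_eq, OfNat.ofNat_ne_zero, not_false_eq_true,
    zero_pow, Finset.sum_const_zero, add_zero, zero_add, Finset.sum_add_distrib,
    sum_sq_prod_centering hn]
  simp
  ring

lemma sum_sq_optimumRight (hn : 0 < n) {a b : ℝ} (ha : 0 < a) (hb : 0 < b)
    (ha2 : a ^ 2 = mtrain) (hb2 : b ^ 2 = mtest) (B₁ B₂ : Fin 2 → ℝ) (τ : ℝ) :
    ∑ x, ∑ l, optimumRight n mtrain mtest B₁ B₂ a b τ x l ^ 2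
      = (n - 1) * (B₁ ⬝ᵥ B₁ + B₂ ⬝ᵥ B₂) + 2 * τ ^ 2 := by
  rw [sum_token, sum_subject, sum_relation]
  simp only [Fintype.sum_sum_type, optimumRight, ne_eq, OfNat.ofNat_ne_zero, not_false_eq_true,
    zero_pow, Finset.sum_const_zero, add_zero, zero_add, Finset.sum_add_distrib, Finset.sum_const,
    Finset.card_univ, Fintype.card_fin, nsmul_eq_mul, div_pow, ← Finset.sum_div, ← Finset.mul_sum,
    sum_sq_prod_centering hn, ← ha2, ← hb2]
  simp
  field_simp
  ring

/-- A feasible matrix whose nuclear norm is the optimal value. -/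
lemma exists_feasible_nuclearNorm_le (hn : 1 < n) {a b : ℝ} (ha : 0 < a) (hb : 0 < b)
    (ha2 : a ^ 2 = mtrain) (hb2 : b ^ 2 = mtest) :
    ∃ W ∈ feasibleSet n mtrain mtest,
      nuclearNorm W ≤ (n - 1) * blockOptimum a b + Real.sqrt n := by
  have hn' : 0 < n := by omega
  have hn0 : (0 : ℝ) < n := by exact_mod_cast hn'
  obtain ⟨A₁, A₂, B₁, B₂, h11, h12, h21, h22, hA, hB⟩ := exists_block_factorization ha hb
  have hs : 0 < Real.sqrt n := Real.sqrt_pos.2 hn0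
  have hs2 := Real.mul_self_sqrt hn0.le
  have ht : 0 < Real.sqrt (Real.sqrt n / 2) := Real.sqrt_pos.2 (by positivity)
  have ht2 := Real.sq_sqrt (by positivity : 0 ≤ Real.sqrt n / 2)
  set τ := Real.sqrt (Real.sqrt n / 2) with hτ
  set g := min (a / b) 1 with hg
  have hg1 : g ≤ 1 := min_le_right _ _
  have hg0 : 0 < g := lt_min (by positivity) one_pos
  -- The product `α * τ = 1 / 2` gives relation entries ±1/2; `τ² = √n / 2` balances `2 * n * α²`
  -- with `2 * τ²`, both equal to √n.
  refine ⟨optimumLeft n mtrain mtest A₁ A₂ (1 / (2 * τ)) *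
    (optimumRight n mtrain mtest B₁ B₂ a b τ)ᵀ, ?_, ?_⟩
  · set W := optimumLeft n mtrain mtest A₁ A₂ (1 / (2 * τ)) *
      (optimumRight n mtrain mtest B₁ B₂ a b τ)ᵀ with hW
    have hp : ∀ i k j, W (.ans (.b i)) (.subj (k, .inl j)) = centering n i k := fun i k j => by
      simp only [hW, Matrix.mul_apply, Matrix.transpose_apply, Fintype.sum_sum_type, optimumLeft,
        optimumRight, sum_prod_centering hn', h11]
      simp [ha.ne']
    have hq : ∀ i k j, W (.ans (.c i)) (.subj (k, .inl j)) = centering n i k := fun i k j => by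
      simp only [hW, Matrix.mul_apply, Matrix.transpose_apply, Fintype.sum_sum_type, optimumLeft,
        optimumRight, sum_prod_centering hn', h21]
      simp [ha.ne']
    have hf : ∀ i k j, W (.ans (.b i)) (.subj (k, .inr j)) = centering n i k := fun i k j => by
      simp only [hW, Matrix.mul_apply, Matrix.transpose_apply, Fintype.sum_sum_type, optimumLeft,
        optimumRight, sum_prod_centering hn', h12]
      simp [hb.ne']
    have hgg : ∀ i k j, W (.ans (.c i)) (.subj (k, .inr j)) = g * centering n i k := fun i k j => by
      simp only [hW, Matrix.mul_apply, Matrix.transpose_apply, Fintype.sum_sum_type, optimumLeft,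
        optimumRight, sum_prod_centering hn', h22]
      simp [hb.ne']
    have hβ₁ : ∀ i, W (.ans (.b i)) (.rel .r₁) = 1 / 2 := fun i => by
      simp only [hW, Matrix.mul_apply, Matrix.transpose_apply, Fintype.sum_sum_type, optimumLeft,
        optimumRight, mul_zero, Finset.sum_const_zero]
      simp
      field_simp
    have hβ₂ : ∀ i, W (.ans (.b i)) (.rel .r₂) = -(1 / 2) := fun i => by
      simp only [hW, Matrix.mul_apply, Matrix.transpose_apply, Fintype.sum_sum_type, optimumLeft,
        optimumRight, mul_zero, Finset.sum_const_zero]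
      simp
      field_simp
    have hγ₁ : ∀ i, W (.ans (.c i)) (.rel .r₁) = -(1 / 2) := fun i => by
      simp only [hW, Matrix.mul_apply, Matrix.transpose_apply, Fintype.sum_sum_type, optimumLeft,
        optimumRight, mul_zero, Finset.sum_const_zero]
      simp
      field_simp
    have hγ₂ : ∀ i, W (.ans (.c i)) (.rel .r₂) = 1 / 2 := fun i => by
      simp only [hW, Matrix.mul_apply, Matrix.transpose_apply, Fintype.sum_sum_type, optimumLeft,
        optimumRight, mul_zero, Finset.sum_const_zero]
      simp
      field_simp
    have hcc : ∀ i k : Fin n, centering n i k ≤ centering n k k := fun i k => by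
      simp only [centering_apply, Matrix.one_apply_eq, Matrix.one_apply]
      split_ifs <;> linarith
    have hdiag : ∀ k : Fin n, 0 ≤ centering n k k := fun k => by
      rw [centering_apply, Matrix.one_apply_eq, sub_nonneg]
      exact inv_le_one_of_one_le₀ (by exact_mod_cast hn.le)
    have hne : ∀ i k : Fin n, i ≠ k → centering n k k = centering n i k + 1 := fun i k h => by
      rw [centering_apply, centering_apply, Matrix.one_apply_eq, Matrix.one_apply_ne h]
      ring
    rintro ⟨k, j | j⟩ r hsr a' ha'
    · rcases r with _ | _ <;> rcases a' with i | i <;>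
        simp only [margin, logit, correctAnswer, hp, hq, hβ₁, hβ₂, hγ₁, hγ₂]
      · have := hne i k (by simpa [correctAnswer] using ha'); linarith
      · have := hcc i k; linarith
      · have := hcc i k; linarith
      · have := hne i k (by simpa [correctAnswer] using ha'); linarith
    · have hr : r = .r₁ := by simpa [trainPairs, trainSubjects, testSubjects] using hsr
      subst hr
      rcases a' with i | i <;>
        simp only [margin, logit, correctAnswer, hf, hgg, hβ₁, hγ₁]
      · have := hne i k (by simpa [correctAnswer] using ha'); linarith
      · have h1 := mul_le_mul_of_nonneg_left (hcc i k) hg0.le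
        have h2 := mul_le_of_le_one_left (hdiag k) hg1
        linarith
  · refine (nuclearNorm_mul_transpose_le _ _).trans (le_of_eq ?_)
    rw [sum_sq_optimumLeft hn', sum_sq_optimumRight hn' ha hb ha2 hb2, hA, hB, div_pow, mul_pow, ht2]
    field_simp
    linarith

end Optimum

/-! ### Tightness of the bounds and the test margin. -/

section Factorized

variable {n mtrain mtest : ℕ}

lemma two_le_sq_add_sq {u v : ℝ} (h : 2 ≤ u - v) : 2 ≤ u ^ 2 + v ^ 2 := by
  nlinarith [sq_nonneg (u + v)]

lemma separation_lower_bound {N u v : ℝ} (hN : 0 < N) (X Y : ℝ) (h : 2 ≤ u - v) :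
    2 * N ≤ X ^ 2 + Y ^ 2 + N * (u ^ 2 + v ^ 2) := by
  have h1 := mul_le_mul_of_nonneg_left (two_le_sq_add_sq h) hN.le
  linarith [sq_nonneg X, sq_nonneg Y]

lemma separation_tight {N X Y u v : ℝ} (hN : 0 < N) (h : 2 ≤ u - v)
    (hle : X ^ 2 + Y ^ 2 + N * (u ^ 2 + v ^ 2) ≤ 2 * N) : Y = 0 ∧ v = -1 := by
  have h1 := mul_le_mul_of_nonneg_left (two_le_sq_add_sq h) hN.le
  refine ⟨pow_eq_zero_iff two_ne_zero |>.1 (le_antisymm (by linarith [sq_nonneg X])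
    (sq_nonneg _)), ?_⟩
  have h2 : u ^ 2 + v ^ 2 ≤ 2 :=
    le_of_mul_le_mul_left (by linarith [sq_nonneg X, sq_nonneg Y]) hN
  have h3 : (v + 1) ^ 2 ≤ 0 := by nlinarith [sq_nonneg (u - 1)]
  linarith [pow_eq_zero_iff two_ne_zero |>.1 (le_antisymm h3 (sq_nonneg _))]

lemma le_add_one_sub_div {N g μ : ℝ} (hN : 1 < N) (hg : μ ≤ g) (hμ : μ ≤ 1) :
    μ ≤ g + (1 - g) / N := by
  have hN0 : 0 < N := by linarith
  have h1 : g + (1 - g) / N - μ = ((N - 1) * (g - μ) + (1 - μ)) / N := by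
    field_simp; ring
  have h2 : 0 ≤ ((N - 1) * (g - μ) + (1 - μ)) / N :=
    div_nonneg (add_nonneg (mul_nonneg (by linarith) (by linarith)) (by linarith)) hN0.le
  linarith

lemma margin_ge_of_isSymmetricForm (hn : 1 < n) (hmtrain : 0 < mtrain) (hmtest : 0 < mtest)
    {W : OVMatrix n mtrain mtest} (hW : IsNuclearSVMSolution W)
    (hsym : IsSymmetricForm (reducedBlock W)) (k : Fin n) (j : Fin mtest) {a' : Answer n}
    (ha' : a' ≠ .c k) :
    min (Real.sqrt ((mtrain : ℝ) / (mtest : ℝ))) 1 ≤ margin W (k, .inr j) .r₂ a' := by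
  obtain ⟨p₁, p₂, q₁, q₂, f₁, f₂, g₁, g₂, β₁, β₂, γ₁, γ₂, hp, hq, hf, hg, hβ₁, hβ₂, hγ₁, hγ₂⟩ :=
    hsym
  simp only [reducedBlock, Matrix.submatrix_apply, Sum.elim_inl, Sum.elim_inr]
    at hp hq hf hg hβ₁ hβ₂ hγ₁ hγ₂
  have hn' : 0 < n := by omega
  have hn2 : (2 : ℝ) ≤ n := by exact_mod_cast hn
  have hn0 : (0 : ℝ) < n := by linarith
  rw [Real.sqrt_div (Nat.cast_nonneg _)]
  have ha : 0 < Real.sqrt mtrain := Real.sqrt_pos.2 (by exact_mod_cast hmtrain)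
  have hb : 0 < Real.sqrt mtest := Real.sqrt_pos.2 (by exact_mod_cast hmtest)
  have ha2 : Real.sqrt mtrain ^ 2 = mtrain := Real.sq_sqrt (Nat.cast_nonneg _)
  have hb2 : Real.sqrt mtest ^ 2 = mtest := Real.sq_sqrt (Nat.cast_nonneg _)
  set a := Real.sqrt mtrain
  set b := Real.sqrt mtest
  obtain ⟨W', hW', hW'le⟩ := exists_feasible_nuclearNorm_le hn ha hb ha2 hb2
  have hle : nuclearNorm W ≤ (n - 1) * blockOptimum a b + Real.sqrt n := by
    have h := hW.2 hW'
    simp only [Set.mem_ofPred_eq] at h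
    exact (le_of_sq_le_sq (by linarith) (nuclearNorm_nonneg _)).trans hW'le
  obtain ⟨i₀, i₁, hi⟩ : ∃ i₀ i₁ : Fin n, i₁ ≠ i₀ := ⟨⟨0, by omega⟩, ⟨1, hn⟩, by simp⟩
  have hfeas := hW.1
  have c₁ := hfeas (i₀, .inl ⟨0, hmtrain⟩) .r₁ (by simp [trainPairs, trainSubjects]) (.b i₁)
    (by simpa [correctAnswer] using hi)
  have c₂ := hfeas (i₀, .inl ⟨0, hmtrain⟩) .r₂ (by simp [trainPairs, trainSubjects]) (.c i₁)
    (by simpa [correctAnswer] using hi)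
  have c₃ := hfeas (i₀, .inr ⟨0, hmtest⟩) .r₁ (by simp [trainPairs, testSubjects]) (.b i₁)
    (by simpa [correctAnswer] using hi)
  have c₄ := hfeas (i₀, .inl ⟨0, hmtrain⟩) .r₁ (by simp [trainPairs, trainSubjects]) (.c i₀)
    (by simp [correctAnswer])
  have c₅ := hfeas (i₀, .inl ⟨0, hmtrain⟩) .r₂ (by simp [trainPairs, trainSubjects]) (.b i₀)
    (by simp [correctAnswer])
  simp only [margin, logit, correctAnswer, hp, hq, hf, hβ₁, hβ₂, hγ₁, hγ₂, Matrix.one_apply_eq,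
    Matrix.one_apply_ne hi] at c₁ c₂ c₃ c₄ c₅
  set x := p₁ + n * p₂ - (q₁ + n * q₂) with hx
  set y := f₁ + n * f₂ - (g₁ + n * g₂) with hy
  -- Adding `c₄` and `c₅` cancels the subject entries.
  have hB : 2 ≤ (β₁ - γ₁) - (β₂ - γ₂) := by linarith
  set Q := (a * x) ^ 2 + (b * y) ^ 2 + n * ((β₁ - γ₁) ^ 2 + (β₂ - γ₂) ^ 2) with hQ
  have hQn : 2 * n ≤ Q := separation_lower_bound hn0 _ _ hB
  have hD : 0 < Real.sqrt (Q / 2) := Real.sqrt_pos.2 (by linarith)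
  have hD2 := Real.sq_sqrt (by linarith : 0 ≤ Q / 2)
  set D := Real.sqrt (Q / 2)
  have hcert : ∀ c s ε : ℝ, c ^ 2 + s ^ 2 = 1 → ε ^ 2 = 1 →
      (n - 1) * (c * (a * p₁ + ε * (b * g₁)) + s * (a * q₁ - ε * (b * f₁)))
        ≤ nuclearNorm W - D := fun c s ε hcs hε => by
    -- The weights are proportional to the mean part of `W`, scaled to make the contraction
    -- condition an equality; this direction maximizes the mean pairing, with value `D`.
    have hcon := isContraction_certificate hn' ha hb ha2 hb2 hcs hε
      (η₁ := a * x / (2 * n * D)) (η₂ := b * y / (2 * n * D)) (η₃ := (β₁ - γ₁) / (2 * D))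
      (η₄ := (β₂ - γ₂) / (2 * D)) (le_of_eq (by
        field_simp
        rw [hD2, hQ]
        ring))
    have h := pairing_le_nuclearNorm hcon W
    rw [pairing_certificate hn' ha hb ha2 hb2 c s ε _ _ _ _ hp hq hf hg hβ₁ hβ₂ hγ₁ hγ₂,
      ← hx, ← hy] at h
    have e : n * (a * (a * x / (2 * n * D)) * x + b * (b * y / (2 * n * D)) * y
        + (β₁ - γ₁) / (2 * D) * (β₁ - γ₁) + (β₂ - γ₂) / (2 * D) * (β₂ - γ₂)) = D := by
      field_simp
      rw [hD2, hQ]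
      ring
    rw [e] at h
    linarith
  have hm : (0 : ℝ) < n - 1 := by linarith
  -- The signs `ε = 1` and `ε = -1` run through the rotations and the reflections of the plane.
  obtain ⟨hK0, h₁⟩ := sq_add_sq_le_of_forall_unit (u := a * p₁ + b * g₁) (v := a * q₁ - b * f₁)
    hm.le fun c s hcs => by simpa using hcert c s 1 hcs (by norm_num)
  obtain ⟨-, h₂⟩ := sq_add_sq_le_of_forall_unit (u := a * p₁ - b * g₁) (v := a * q₁ + b * f₁)
    hm.le fun c s hcs => by simpa [← sub_eq_add_neg] using hcert c s (-1) hcs (by norm_num)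
  have hDn : Real.sqrt n ≤ D := Real.sqrt_le_sqrt (by linarith)
  obtain ⟨hf1, hg1, hopt⟩ := block_minimizer ha hb hm (by linarith : 1 ≤ p₁) (by linarith : 1 ≤ q₁)
    (by linarith : 1 ≤ f₁) hK0 h₁ h₂ (by linarith)
  have hQle : Q ≤ 2 * n := by
    have h1 : D ≤ Real.sqrt n := by linarith
    have h2 := (Real.sqrt_le_sqrt_iff hn0.le).1 h1
    linarith
  obtain ⟨hby, hB₂⟩ := separation_tight hn0 hB hQle
  have hy0 : y = 0 := (mul_eq_zero.1 hby).resolve_left hb.ne'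
  set μ := min (a / b) 1
  have hμ : μ ≤ 1 := min_le_right _ _
  have hfg : g₂ - f₂ = (1 - g₁) / n := by
    rw [eq_div_iff hn0.ne']
    rw [hy, hf1] at hy0
    linarith
  -- A convex combination of `g₁` and `1`, both at least `μ`; it bounds the margin against fact
  -- answers, while `g₁` itself is the margin against implications.
  have hμ' : μ ≤ g₁ + (1 - g₁) / n := le_add_one_sub_div (by linarith) hg1 hμ
  rcases a' with i | i <;>
    simp only [margin, logit, correctAnswer, hf, hg, hβ₂, hγ₂, Matrix.one_apply_eq, hf1]
  · have : (1 : Matrix (Fin n) (Fin n) ℝ) i k ≤ 1 := by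
      rw [Matrix.one_apply]; split_ifs <;> norm_num
    linarith
  · rw [Matrix.one_apply_ne (by simpa using ha')]
    linarith

end Factorized

end OCR

theorem theorem2 (n mtrain mtest : ℕ) (hn : 1 < n) (hmtrain : 0 < mtrain) :
    (∀ W : OCR.OVMatrix n mtrain mtest, OCR.IsNuclearSVMSolution W → OCR.RegularityCondition W →
      ∀ s r, (s, r) ∈ OCR.testPairs n mtrain mtest → ∀ a', a' ≠ OCR.correctAnswer s r →
        min (Real.sqrt ((mtrain : ℝ) / (mtest : ℝ))) 1 ≤ OCR.margin W s r a') ∧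
    (∀ W : OCR.OVMatrix n mtrain mtest, OCR.IsFrobeniusSVMSolution W →
      ∀ s r, (s, r) ∈ OCR.testPairs n mtrain mtest →
        ∀ a' ∈ OCR.implicationAnswers n, a' ≠ OCR.correctAnswer s r → OCR.margin W s r a' = 0) := by
  refine ⟨fun W hW hreg s r hsr a' ha' => ?_, fun W hW s r hsr a' ha' _ =>
    hW.margin_eq_zero hsr ha'⟩
  obtain ⟨k, j | j⟩ := s
  · simp [OCR.testPairs, OCR.testSubjects] at hsr
  · have hr : r = .r₂ := by simpa [OCR.testPairs, OCR.testSubjects] using hsr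
    subst hr
    exact OCR.margin_ge_of_isSymmetricForm hn hmtrain j.pos hW
      (hreg.resolve_right fun h => h (hW.vecMul_reducedBlock hn)) k j ha'
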